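/- **Setting.** Let $U\subset\mathbb{R}^{m}$ and $D\subset\mathbb{R}^{k}$ be nonempty compact sets and let $f:\mathbb{R}^n\times U\times D\to\mathbb{R}^n$ be uniformly continuous, bounded, and Lipschitz continuous in $x\in\mathbb{R}^n$ with a Lipschitz constant that does not depend on $(u,d)\in U\times D$. Let $h_S:\mathbb{R}^n\to\mathbb{R}$ be continuous with $|h_S(x)|\le C(1+\|x\|)$ for some constant $C$ and all $x$ (for example, continuous and bounded, or Lipschitz continuous), and let $\gamma>0$. Let $\mathcal{U}^-$ and $\mathcal{D}^-$ be the sets of Lebesgue measurable functions $(-\infty,0]\to U$ and $(-\infty,0]\to D$. Let $\Xi_d^-$ be the set of (backward in time) non-anticipative strategies, i.e. maps $\xi_d^-:\mathcal{U}^-\to\mathcal{D}^-$ such that for all $s\le 0$ and $\mathrm{u}^-,\bar{\mathrm{u}}^-\in\mathcal{U}^-$, if $\mathrm{u}^-=\bar{\mathrm{u}}^-$ a.e. on $[s,0]$ then $\xi_d^-[\mathrm{u}^-]=\xi_d^-[\bar{\mathrm{u}}^-]$ a.e. on $[s,0]$. For $x\in\mathbb{R}^n$, $\mathrm{u}^-\in\mathcal{U}^-$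 and $\xi_d^-\in\Xi_d^-$ let $\mathrm{x}^-:(-\infty,0]\to\mathbb{R}^n$ be the solution (in the Carathéodory sense) of $$\dot{\mathrm{x}}^-(t)=f\big(\mathrm{x}^-(t),\mathrm{u}^-(t),\xi_d^-[\mathrm{u}^-](t)\big)\ \text{ for a.e. } t<0,\qquad \mathrm{x}^-(0)=x,$$ and define $$V_\gamma(x):=\sup_{\xi_d^-\in\Xi_d^-}\ \inf_{\mathrm{u}^-\in\mathcal{U}^-}\ \sup_{t\in(-\infty,0]} e^{\gamma t}h_S(\mathrm{x}^-(t)).$$ **Theorem (dynamic programming principle).** The solution on $(-\infty,0]$ of $\dot{\mathrm{x}}^-=f(\mathrm{x}^-,\mathrm{u}^-,\mathrm{d}^-)$ a.e., $\mathrm{x}^-(0)=x$, exists and is unique for all $x\in\mathbb{R}^n$, $\mathrm{u}^-\in\mathcal{U}^-$, $\mathrm{d}^-\in\mathcal{D}^-$; the suprema and infima defining $V_\gamma$ are finite, so that $V_\gamma:\mathbb{R}^n\to\mathbb{R}$ is well defined; and for every $x\in\mathbb{R}^n$ and every $T>0$, $$V_\gamma(x)=\sup_{\xi_d^-\in\Xi_d^-}\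 \inf_{\mathrm{u}^-\in\mathcal{U}^-}\ \max\Big\{\max_{t\in[-T,0]} e^{\gamma t}h_S(\mathrm{x}^-(t)),\ e^{-\gamma T}V_\gamma\big(\mathrm{x}^-(-T)\big)\Big\},$$ where the inner maximum is attained and the supremum and infima on the right-hand side are finite. -/

import Mathlib

open MeasureTheory Set

noncomputable section

/-- `ℝⁿ` with the Euclidean norm. -/
abbrev Vec (n : ℕ) : Type := EuclideanSpace ℝ (Fin n)

/-- Lebesgue measurable backward signals `(-∞, 0] → A`. A signal is written as a function on `ℝ`;
only its values at times `t ≤ 0` are constrained, and only those are ever used. -/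
def BackwardSignal {m : ℕ} (A : Set (Vec m)) : Type :=
  {a : ℝ → Vec m // AEMeasurable a (volume.restrict (Iic 0)) ∧ ∀ t ≤ 0, a t ∈ A}

/-- Two backward signals agree almost everywhere on `[s, 0]`. -/
def AgreeOn {m : ℕ} {A : Set (Vec m)} (s : ℝ) (a b : BackwardSignal A) : Prop :=
  ∀ᵐ τ ∂(volume.restrict (Icc s 0)), a.1 τ = b.1 τ

/-- Disturbance strategies that are non-anticipative backward in time. -/
def BackwardStrategy {m k : ℕ} (U : Set (Vec m)) (D : Set (Vec k)) : Type :=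
  {σ : BackwardSignal U → BackwardSignal D //
    ∀ s ≤ 0, ∀ u v : BackwardSignal U, AgreeOn s u v → AgreeOn s (σ u) (σ v)}

section Dynamics

variable {n m k : ℕ} {U : Set (Vec m)} {D : Set (Vec k)}

/-- `y` solves `y' = f(y, u, d)` on `(-∞, 0)` with `y(0) = x`, in the sense of Carathéodory, that is,
in integral form; only the values of `y` at times `t ≤ 0` matter. -/
def IsBackwardTrajectory (f : Vec n → Vec m → Vec k → Vec n) (u : BackwardSignal U)
    (d : BackwardSignal D) (x : Vec n) (y : ℝ → Vec n) : Prop :=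
  ∀ t ≤ 0, IntervalIntegrable (fun s => f (y s) (u.1 s) (d.1 s)) volume 0 t ∧
    y t = x + ∫ s in (0 : ℝ)..t, f (y s) (u.1 s) (d.1 s)

/-- The backward trajectory with terminal state `x` (a chosen solution of the equation). -/
def backwardTrajectory (f : Vec n → Vec m → Vec k → Vec n) (u : BackwardSignal U)
    (d : BackwardSignal D) (x : Vec n) : ℝ → Vec n :=
  Classical.epsilon (IsBackwardTrajectory f u d x)

/-- The discounted payoff `e^{γ t} h(x⁻(t))` at time `t`. -/
def payoff (f : Vec n → Vec m → Vec k → Vec n) (h : Vec n → ℝ) (γ : ℝ) (x : Vec n)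
    (u : BackwardSignal U) (d : BackwardSignal D) (t : ℝ) : ℝ :=
  Real.exp (γ * t) * h (backwardTrajectory f u d x t)

/-- The cost functional: the supremum of the discounted payoff over `(-∞, 0]`. -/
def cost (f : Vec n → Vec m → Vec k → Vec n) (h : Vec n → ℝ) (γ : ℝ) (x : Vec n)
    (u : BackwardSignal U) (σ : BackwardStrategy U D) : ℝ :=
  sSup (payoff f h γ x u (σ.1 u) '' Iic 0)

/-- The supremum (for a continuous payoff, the maximum) of the discounted payoff
over `[-T, 0]`. -/
def horizonMax (f : Vec n → Vec m → Vec k → Vec n) (h : Vec n → ℝ) (γ : ℝ) (T : ℝ) (x : Vec n)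
    (u : BackwardSignal U) (σ : BackwardStrategy U D) : ℝ :=
  sSup (payoff f h γ x u (σ.1 u) '' Icc (-T) 0)

/-- The forward reachable tube value function: supremum over strategies of the infimum over
controls of the cost. -/
def valueFunction (U : Set (Vec m)) (D : Set (Vec k)) (f : Vec n → Vec m → Vec k → Vec n)
    (h : Vec n → ℝ) (γ : ℝ) (x : Vec n) : ℝ :=
  ⨆ σ : BackwardStrategy U D, ⨅ u : BackwardSignal U, cost f h γ x u σ

/-- The quantity `max { max_{t ∈ [-T, 0]} e^{γ t} h(x⁻(t)), e^{-γ T} V_γ(x⁻(-T)) }`. -/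
def dynProgCost (f : Vec n → Vec m → Vec k → Vec n) (h : Vec n → ℝ) (γ : ℝ) (T : ℝ) (x : Vec n)
    (u : BackwardSignal U) (σ : BackwardStrategy U D) : ℝ :=
  max (horizonMax f h γ T x u σ)
    (Real.exp (-(γ * T)) *
      valueFunction U D f h γ (backwardTrajectory f u (σ.1 u) x (-T)))

end Dynamics

/-- All infima and the supremum in `⨆ a, ⨅ b, F a b` are those of bounded sets, so that the
expression is a genuine real sup-inf. -/
def SupInfFinite {α β : Type*} (F : α → β → ℝ) : Prop :=
  (∀ a, BddBelow (range (F a))) ∧ BddAbove (range fun a => ⨅ b, F a b)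

end

open MeasureTheory Set

noncomputable section

/-! The cost splits at time `-T`. By time invariance and uniqueness of trajectories, the part of a
trajectory before `-T` is the trajectory of the shifted signals from `z = x⁻(-T)`, and the discount
contributes the factor `e^{-γT}`. So the cost is the maximum of the payoff on `[-T, 0]` and
`e^{-γT}` times the cost of a game restarted at `z` (`sSup_payoff_split`). Both inequalities follow
from ε-optimal choices.

For `≤`, fix a nearly optimal strategy `σ` and a control `u`. What `σ` does before `-T`, once `u` is
fixed on `[-T, 0]`, is a strategy for the game at `z`. Some control `v` keeps its cost below `V(z) +
ε/3`, and `σ` is tested against `u` continued by `v`.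

For `≥`, follow a nearly optimal `σ` of the right-hand side on `[-T, 0]`, then a nearly optimal
strategy for the state reached. This is non-anticipative because that state depends only on the
control on `[-T, 0]`, which is already known at earlier times.

Finiteness holds because trajectories and `h` grow at most linearly while the discount is
exponential. Existence and uniqueness of trajectories come from one contraction on the whole
half-line, in an exponentially weighted norm. -/

lemma intervalIntegrable_of_norm_le_of_aestronglyMeasurable {E : Type*} [NormedAddCommGroup E]
    {M : ℝ} {g : ℝ → E}
    (hg : AEStronglyMeasurable g volume) (hM : ∀ s, ‖g s‖ ≤ M) (a b : ℝ) :
    IntervalIntegrable g volume a b :=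
  (intervalIntegrable_const (c := M)).mono_fun hg.restrict
    (Filter.Eventually.of_forall fun s => (hM s).trans (le_abs_self M))

/-- An exponential weight absorbs linear growth in time. This bounds the weighted Picard iterates
and, with `r = γ`, the discounted payoff. -/
lemma exp_neg_mul_abs_mul_abs_le {r : ℝ} (hr : 0 < r) (t : ℝ) :
    Real.exp (-(r * |t|)) * |t| ≤ r⁻¹ := by
  have h1 : r * |t| ≤ Real.exp (r * |t|) := by
    linarith [Real.add_one_le_exp (r * |t|)]
  rw [Real.exp_neg, inv_mul_le_iff₀ (Real.exp_pos _)]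
  rw [← div_eq_mul_inv, le_div_iff₀ hr]
  linarith

lemma integral_exp_neg_mul {r : ℝ} (hr : 0 < r) (t : ℝ) :
    ∫ s in t..0, Real.exp (-(r * s)) = (Real.exp (-(r * t)) - 1) * r⁻¹ := by
  have hderiv : ∀ s ∈ uIcc t 0, HasDerivAt (fun s => -(Real.exp (-(r * s)) * r⁻¹))
      (Real.exp (-(r * s))) s := by
    intro s _
    have h1 : HasDerivAt (fun s : ℝ => -(r * s)) (-(r * 1)) s :=
      ((hasDerivAt_id s).const_mul r).neg
    have h2 := ((h1.exp).mul_const r⁻¹).neg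
    refine h2.congr_deriv ?_
    rw [mul_one, mul_neg, neg_mul, neg_neg, mul_assoc, mul_inv_cancel₀ hr.ne', mul_one]
  rw [intervalIntegral.integral_eq_sub_of_hasDerivAt hderiv
    ((by fun_prop : Continuous fun s : ℝ => Real.exp (-(r * s))).intervalIntegrable _ _)]
  simp
  ring

/-! ### Existence and uniqueness of Carathéodory solutions -/

section Caratheodory

variable {E : Type*} [NormedAddCommGroup E] [NormedSpace ℝ E] {G : ℝ → E → E} {M : ℝ}
  {L : NNReal}

/-- The Picard operator in exponentially weighted coordinates. -/
def weightedPicard (G : ℝ → E → E) (x : E) (r : ℝ) (z : ℝ → E) (t : ℝ) : E :=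
  Real.exp (-(r * |t|)) • ∫ s in (0 : ℝ)..t, G s (x + Real.exp (r * |s|) • z s)

lemma weighted_integral_bound {g : ℝ → E} {r : ℝ} (hr : 0 < r)
    (hM : ∀ s, ‖g s‖ ≤ M) (t : ℝ) :
    ‖Real.exp (-(r * |t|)) • ∫ s in (0 : ℝ)..t, g s‖ ≤ M * r⁻¹ := by
  have hM0 : 0 ≤ M := (norm_nonneg _).trans (hM 0)
  have h1 : ‖∫ s in (0 : ℝ)..t, g s‖ ≤ M * |t| := by
    simpa using intervalIntegral.norm_integral_le_of_norm_le_const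
      (a := 0) (b := t) (f := g) (C := M) fun s _ => hM s
  rw [norm_smul, Real.norm_of_nonneg (Real.exp_pos _).le]
  calc _ ≤ Real.exp (-(r * |t|)) * (M * |t|) := by gcongr
    _ = M * (Real.exp (-(r * |t|)) * |t|) := by ring
    _ ≤ _ := by gcongr; exact exp_neg_mul_abs_mul_abs_le hr t

lemma continuous_weighted_integral {g : ℝ → E} (r : ℝ)
    (hg : ∀ a b, IntervalIntegrable g volume a b) :
    Continuous fun t => Real.exp (-(r * |t|)) • ∫ s in (0 : ℝ)..t, g s :=
  (by fun_prop : Continuous fun t : ℝ => Real.exp (-(r * |t|))).smul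
    (intervalIntegral.continuous_primitive hg 0)

/-- In unweighted coordinates the two curves differ by at most `c e^{r|s|}`. Integrating the
Lipschitz bound costs a factor `1/r`, and the outer weight cancels the exponential. The constant
`L/r` is uniform in `t`, so no continuation argument is needed. -/
lemma dist_weightedPicard_le (hzero : ∀ s, 0 < s → ∀ y, G s y = 0)
    (hlip : ∀ s, LipschitzWith L (G s)) (hbdd : ∀ s y, ‖G s y‖ ≤ M)
    (hmeas : ∀ y : ℝ → E, Continuous y → AEStronglyMeasurable (fun s => G s (y s)) volume)
    (x : E) {r : ℝ} (hr : 0 < r) {z w : ℝ → E} (hz : Continuous z) (hw : Continuous w) {c : ℝ}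
    (hc : ∀ s, dist (z s) (w s) ≤ c) (t : ℝ) :
    dist (weightedPicard G x r z t) (weightedPicard G x r w t) ≤ L * r⁻¹ * c := by
  have hc0 : 0 ≤ c := dist_nonneg.trans (hc 0)
  rcases le_total 0 t with ht | ht
  · have hz0 : ∀ z : ℝ → E, weightedPicard G x r z t = 0 := by
      intro z
      have : ∫ s in (0 : ℝ)..t, G s (x + Real.exp (r * |s|) • z s) = ∫ s in (0 : ℝ)..t, (0 : E) := by
        apply intervalIntegral.integral_congr_ae
        refine Filter.Eventually.of_forall fun s hs => ?_
        rw [uIoc_of_le ht] at hs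
        exact hzero s hs.1 _
      rw [weightedPicard, this]
      simp
    rw [hz0 z, hz0 w, dist_self]
    positivity
  · have hi : ∀ z : ℝ → E, Continuous z → ∀ a b, IntervalIntegrable
        (fun s => G s (x + Real.exp (r * |s|) • z s)) volume a b := fun z hz =>
      intervalIntegrable_of_norm_le_of_aestronglyMeasurable
        (hmeas (fun s => x + Real.exp (r * |s|) • z s) (by fun_prop)) (fun s => hbdd _ _)
    rw [weightedPicard, weightedPicard, dist_eq_norm, ← smul_sub,
      ← intervalIntegral.integral_sub (hi z hz _ _) (hi w hw _ _), norm_smul,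
      Real.norm_of_nonneg (Real.exp_pos _).le, intervalIntegral.integral_symm, norm_neg]
    have hb : ‖∫ s in t..0, (G s (x + Real.exp (r * |s|) • z s) -
        G s (x + Real.exp (r * |s|) • w s))‖ ≤ ∫ s in t..0, L * c * Real.exp (-(r * s)) := by
      apply intervalIntegral.norm_integral_le_of_norm_le ht
      · refine Filter.Eventually.of_forall fun s hs => ?_
        rw [← dist_eq_norm]
        refine ((hlip s).dist_le_mul _ _).trans ?_
        rw [dist_add_left, dist_smul₀, Real.norm_of_nonneg (Real.exp_pos _).le,
          abs_of_nonpos hs.2, mul_neg, mul_assoc, mul_comm c]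
        gcongr
        exact hc s
      · exact (by fun_prop : Continuous fun s : ℝ => L * c * Real.exp (-(r * s))).intervalIntegrable
          _ _
    rw [intervalIntegral.integral_const_mul, integral_exp_neg_mul hr] at hb
    rw [abs_of_nonpos ht, mul_neg, neg_neg]
    calc _ ≤ Real.exp (r * t) * (L * c * ((Real.exp (-(r * t)) - 1) * r⁻¹)) := by gcongr
      _ = (L * r⁻¹ * c) * (Real.exp (r * t) * Real.exp (-(r * t)) - Real.exp (r * t)) := by ring
      _ ≤ (L * r⁻¹ * c) * 1 := by
        gcongr
        rw [← Real.exp_add]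
        simp [(Real.exp_pos _).le]
      _ = _ := mul_one _

/-- Existence and uniqueness on `(-∞, 0]` for a bounded Lipschitz vector field that vanishes at
positive times. -/
lemma exists_unique_integral_curve_of_zero [CompleteSpace E] (hzero : ∀ s, 0 < s → ∀ y, G s y = 0)
    (hlip : ∀ s, LipschitzWith L (G s)) (hbdd : ∀ s y, ‖G s y‖ ≤ M)
    (hmeas : ∀ y : ℝ → E, Continuous y → AEStronglyMeasurable (fun s => G s (y s)) volume)
    (x : E) :
    ∃ y : ℝ → E, (∀ t, IntervalIntegrable (fun s => G s (y s)) volume 0 t ∧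
      y t = x + ∫ s in (0 : ℝ)..t, G s (y s)) ∧
      ∀ w : ℝ → E, (∀ t, IntervalIntegrable (fun s => G s (w s)) volume 0 t ∧
        w t = x + ∫ s in (0 : ℝ)..t, G s (w s)) → w = y := by
  -- Any weight `r > L` makes the Picard operator a contraction.
  obtain ⟨r, hr, hLr⟩ : ∃ r : ℝ, 0 < r ∧ (L : ℝ) * r⁻¹ < 1 := by
    refine ⟨L + 1, by positivity, ?_⟩
    rw [← div_eq_mul_inv, div_lt_one (by positivity)]
    linarith
  have hi : ∀ y : ℝ → E, Continuous y → ∀ a b, IntervalIntegrable (fun s => G s (y s)) volume a b :=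
    fun y hy => intervalIntegrable_of_norm_le_of_aestronglyMeasurable (hmeas y hy)
      (fun s => hbdd _ _)
  let N : BoundedContinuousFunction ℝ E → BoundedContinuousFunction ℝ E := fun z =>
    BoundedContinuousFunction.ofNormedAddCommGroup (weightedPicard G x r z)
      (continuous_weighted_integral r
        (hi (fun s => x + Real.exp (r * |s|) • z s) (by fun_prop)))
      (M * r⁻¹) (weighted_integral_bound hr fun s => hbdd _ _)
  have hN : ContractingWith (L * (Real.toNNReal r)⁻¹) N := by
    refine ⟨?_, LipschitzWith.of_dist_le_mul fun z w => ?_⟩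
    · rw [← NNReal.coe_lt_coe]
      simpa [Real.coe_toNNReal r hr.le] using hLr
    · rw [BoundedContinuousFunction.dist_le (by positivity)]
      intro t
      have := dist_weightedPicard_le hzero hlip hbdd hmeas x hr z.continuous w.continuous
        (fun s => BoundedContinuousFunction.dist_coe_le_dist s) t
      rw [NNReal.coe_mul, NNReal.coe_inv, Real.coe_toNNReal r hr.le]
      exact this
  have hcancel : ∀ (t : ℝ) (v : E), Real.exp (r * |t|) • Real.exp (-(r * |t|)) • v = v := by
    intro t v
    rw [smul_smul, ← Real.exp_add]
    simp
  set z := ContractingWith.fixedPoint N hN with hz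
  have hfix : N z = z := hN.fixedPoint_isFixedPt
  refine ⟨fun t => x + Real.exp (r * |t|) • z t, fun t => ⟨hi _ (by fun_prop) _ _, ?_⟩,
    fun w hw => ?_⟩
  · have : z t = weightedPicard G x r z t := (DFunLike.congr_fun hfix t).symm
    simp only
    conv_lhs => rw [this]
    rw [weightedPicard, hcancel]
  -- Uniqueness needs no growth assumption on `w`: as `G` is bounded, the weighted form of any
  -- solution is bounded and continuous, hence a fixed point of `N`.
  · have hwc := continuous_weighted_integral r
      (fun a b => ((hw a).1.symm.trans (hw b).1))
    let v : BoundedContinuousFunction ℝ E :=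
      BoundedContinuousFunction.ofNormedAddCommGroup _ hwc (M * r⁻¹)
        (weighted_integral_bound hr fun s => hbdd _ _)
    have hvw : ∀ t, x + Real.exp (r * |t|) • v t = w t := by
      intro t
      rw [(hw t).2]
      congr 1
      exact hcancel t _
    have hv : N v = v := by
      ext t
      change weightedPicard G x r v t = _
      simp only [weightedPicard, hvw]
      rfl
    have hvz : v = z := hN.fixedPoint_unique hv
    funext t
    rw [← hvz, hvw]

/-- Existence and uniqueness of Carathéodory solutions on `(-∞, 0]`. -/
lemma exists_unique_integral_curve [CompleteSpace E]
    (hlip : ∀ s ≤ 0, LipschitzWith L (G s)) (hbdd : ∀ s ≤ 0, ∀ y, ‖G s y‖ ≤ M)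
    (hmeas : ∀ y : ℝ → E, Continuous y →
      AEStronglyMeasurable (fun s => G s (y s)) (volume.restrict (Iic 0)))
    (x : E) :
    ∃ y : ℝ → E, (∀ t ≤ 0, IntervalIntegrable (fun s => G s (y s)) volume 0 t ∧
      y t = x + ∫ s in (0 : ℝ)..t, G s (y s)) ∧
      ∀ w : ℝ → E, (∀ t ≤ 0, IntervalIntegrable (fun s => G s (w s)) volume 0 t ∧
        w t = x + ∫ s in (0 : ℝ)..t, G s (w s)) → EqOn w y (Iic 0) := by
  have hM0 : 0 ≤ M := (norm_nonneg _).trans (hbdd 0 le_rfl 0)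
  -- Extending the field by zero to positive times turns the problem into one on all of `ℝ`.
  let G' : ℝ → E → E := fun s y => (Iic (0 : ℝ)).indicator (fun s => G s y) s
  have hneg : ∀ s ≤ 0, G' s = G s := fun s hs => funext fun y => indicator_of_mem (mem_Iic.2 hs) _
  have hpos : ∀ s, 0 < s → ∀ y, G' s y = 0 := fun s hs y =>
    indicator_of_notMem (by simpa using hs) _
  obtain ⟨y, hy, hyu⟩ := exists_unique_integral_curve_of_zero (G := G') (L := L) (M := M) hpos
    (fun s => by
      rcases le_or_gt s 0 with hs | hs
      · rw [hneg s hs]; exact hlip s hs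
      · have : G' s = fun _ => 0 := funext (hpos s hs)
        rw [this]; exact (LipschitzWith.const (0 : E)).weaken bot_le)
    (fun s y => by
      rcases le_or_gt s 0 with hs | hs
      · rw [hneg s hs]; exact hbdd s hs y
      · rw [hpos s hs]; simpa using hM0)
    (fun y hy => by
      have := (aestronglyMeasurable_indicator_iff measurableSet_Iic).2 (hmeas y hy)
      refine this.congr (Filter.Eventually.of_forall fun s => ?_)
      by_cases hs : s ∈ Iic (0 : ℝ) <;> simp [G', hs])
    x
  have hcongr : ∀ t ≤ (0 : ℝ), ∀ w : ℝ → E, EqOn (fun s => G' s (w s)) (fun s => G s (w s))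
      (uIcc 0 t) := by
    intro t ht w s hs
    rw [uIcc_of_ge ht] at hs
    simp only [hneg s hs.2]
  refine ⟨y, fun t ht => ⟨(hy t).1.congr ((hcongr t ht y).mono uIoc_subset_uIcc), ?_⟩,
    fun w hw => ?_⟩
  · rw [(hy t).2]
    congr 1
    exact intervalIntegral.integral_congr (hcongr t ht y)
  -- `w` is arbitrary at positive times; freezing it at `w 0` there gives a solution of the extended
  -- equation.
  · let w' : ℝ → E := fun t => w (min t 0)
    have hcw : EqOn w' w (Iic 0) := fun t ht => by simp only [w', min_eq_left (mem_Iic.1 ht)]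
    have hw' : ∀ t, IntervalIntegrable (fun s => G' s (w' s)) volume 0 t ∧
        w' t = x + ∫ s in (0 : ℝ)..t, G' s (w' s) := by
      intro t
      rcases le_total t 0 with ht | ht
      · have he : EqOn (fun s => G s (w s)) (fun s => G' s (w' s)) (uIcc 0 t) := by
          intro s hs
          rw [uIcc_of_ge ht] at hs
          simp only [hneg s hs.2, hcw (mem_Iic.2 hs.2)]
        refine ⟨(hw t ht).1.congr (he.mono uIoc_subset_uIcc), ?_⟩
        rw [hcw (mem_Iic.2 ht), (hw t ht).2]
        congr 1
        exact intervalIntegral.integral_congr he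
      · have he : EqOn (fun _ => (0 : E)) (fun s => G' s (w' s)) (uIoc 0 t) := by
          intro s hs
          rw [uIoc_of_le ht] at hs
          exact (hpos s hs.1 _).symm
        refine ⟨(intervalIntegrable_const (c := (0 : E))).congr he, ?_⟩
        rw [← intervalIntegral.integral_congr_ae (Filter.Eventually.of_forall fun s hs => he hs)]
        have := (hw 0 le_rfl).2
        simpa [w', min_eq_right ht] using this
    intro t ht
    rw [← hcw ht, hyu w' hw']

end Caratheodory

/-! ### Shifting and concatenating signals -/

section Signals

variable {m : ℕ} {A : Set (Vec m)}

lemma AgreeOn.refl (s : ℝ) (a : BackwardSignal A) : AgreeOn s a a :=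
  Filter.Eventually.of_forall fun _ => rfl

lemma AgreeOn.symm {s : ℝ} {a b : BackwardSignal A} (h : AgreeOn s a b) : AgreeOn s b a :=
  Filter.Eventually.mono h fun _ => Eq.symm

lemma AgreeOn.trans {s : ℝ} {a b c : BackwardSignal A} (h : AgreeOn s a b) (h' : AgreeOn s b c) :
    AgreeOn s a c := by
  filter_upwards [h, h'] with τ h1 h2 using h1.trans h2

lemma AgreeOn.mono {s t : ℝ} {a b : BackwardSignal A} (h : AgreeOn s a b) (hst : s ≤ t) :
    AgreeOn t a b :=
  ae_restrict_of_ae_restrict_of_subset (Icc_subset_Icc_left hst) h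

lemma measurePreserving_sub_restrict (T : ℝ) (s : Set ℝ) (hs : MeasurableSet s) :
    MeasurePreserving (fun τ : ℝ => τ - T) (volume.restrict ((fun τ => τ - T) ⁻¹' s))
      (volume.restrict s) :=
  (measurePreserving_sub_right volume T).restrict_preimage hs

lemma ae_restrict_Icc_comp_sub {p : ℝ → Prop} {a b : ℝ} (T : ℝ)
    (h : ∀ᵐ τ ∂(volume.restrict (Icc a b)), p τ) :
    ∀ᵐ τ ∂(volume.restrict (Icc (a + T) (b + T))), p (τ - T) := by
  have := (measurePreserving_sub_restrict T (Icc a b) measurableSet_Icc).quasiMeasurePreserving.ae h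
  simpa using this

lemma aemeasurable_comp_sub_Iic {a : ℝ → Vec m} {b : ℝ} (T : ℝ)
    (h : AEMeasurable a (volume.restrict (Iic b))) :
    AEMeasurable (fun τ => a (τ - T)) (volume.restrict (Iic (b + T))) := by
  have := (h.comp_quasiMeasurePreserving
    (measurePreserving_sub_restrict T (Iic b) measurableSet_Iic).quasiMeasurePreserving)
  simpa [Function.comp_def] using this

lemma aemeasurable_concat {T : ℝ} (hT : 0 ≤ T) {a b : ℝ → Vec m}
    (ha : AEMeasurable a (volume.restrict (Iic 0))) (hb : AEMeasurable b (volume.restrict (Iic 0))) :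
    AEMeasurable (fun t => if -T < t then a t else b (t + T)) (volume.restrict (Iic 0)) := by
  have hunion : Iic (0 : ℝ) = Ioc (-T) 0 ∪ Iic (-T) := by
    rw [union_comm, Iic_union_Ioc_eq_Iic (by linarith)]
  rw [hunion, aemeasurable_union_iff]
  constructor
  · refine (ha.mono_measure (Measure.restrict_mono Ioc_subset_Iic_self le_rfl)).congr ?_
    filter_upwards [ae_restrict_mem measurableSet_Ioc] with t ht
    rw [if_pos ht.1]
  · have h := aemeasurable_comp_sub_Iic (-T) hb
    rw [zero_add] at h
    refine h.congr ?_
    filter_upwards [ae_restrict_mem measurableSet_Iic] with t ht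
    rw [if_neg (not_lt.2 ht), sub_neg_eq_add]

/-- The part of a signal before time `-T`, moved to end at time `0`. -/
def BackwardSignal.shift {T : ℝ} (hT : 0 ≤ T) (a : BackwardSignal A) : BackwardSignal A :=
  ⟨fun τ => a.1 (τ - T), by
    have h : AEMeasurable a.1 (volume.restrict (Iic (-T))) :=
      a.2.1.mono_measure (Measure.restrict_mono (Iic_subset_Iic.2 (by linarith)) le_rfl)
    simpa using aemeasurable_comp_sub_Iic T h, fun t ht => a.2.2 _ (by linarith)⟩

/-- The signal equal to `a` on `(-T, 0]`, continued by `b` before time `-T`. -/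
def BackwardSignal.concat {T : ℝ} (hT : 0 ≤ T) (a b : BackwardSignal A) : BackwardSignal A :=
  ⟨fun t => if -T < t then a.1 t else b.1 (t + T), aemeasurable_concat hT a.2.1 b.2.1, fun t ht => by
    change (if -T < t then a.1 t else b.1 (t + T)) ∈ A
    split_ifs with h
    · exact a.2.2 t ht
    · exact b.2.2 _ (by linarith)⟩

variable {T : ℝ} (hT : 0 ≤ T)

lemma agreeOn_concat_left (a b : BackwardSignal A) : AgreeOn (-T) (a.concat hT b) a := by
  -- At `-T` itself the concatenation takes the value `b 0`, so agreement with `a` holds only off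
  -- this null set.
  rw [AgreeOn, ← restrict_Ioc_eq_restrict_Icc]
  filter_upwards [ae_restrict_mem measurableSet_Ioc] with t ht
  exact if_pos ht.1

/-- Pointwise, including `τ = 0`, because the concatenation already uses `b` at time `-T`. -/
lemma shift_concat_apply (a b : BackwardSignal A) {τ : ℝ} (hτ : τ ≤ 0) :
    ((a.concat hT b).shift hT).1 τ = b.1 τ := by
  change (if -T < τ - T then a.1 (τ - T) else b.1 (τ - T + T)) = _
  rw [if_neg (by linarith), sub_add_cancel]

lemma AgreeOn.shift {s : ℝ} {a b : BackwardSignal A} (h : AgreeOn (s - T) a b) :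
    AgreeOn s (a.shift hT) (b.shift hT) := by
  have := ae_restrict_Icc_comp_sub T h
  rw [sub_add_cancel, zero_add] at this
  exact ae_restrict_of_ae_restrict_of_subset (Icc_subset_Icc_right hT) this

/-- Signals built by concatenation agree on `[s, 0]` if their pieces agree there. -/
lemma AgreeOn.concat {s : ℝ} {a a' b b' : BackwardSignal A} (ha : AgreeOn (max s (-T)) a a')
    (hb : s ≤ -T → AgreeOn (s + T) b b') : AgreeOn s (a.concat hT b) (a'.concat hT b') := by
  rcases le_or_gt s (-T) with hs | hs
  · rw [max_eq_right hs] at ha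
    have h1 := ae_restrict_Icc_comp_sub (-T) (hb hs)
    rw [zero_add, add_neg_cancel_right] at h1
    rw [AgreeOn, ← Icc_union_Icc_eq_Icc hs (by linarith : -T ≤ 0), ae_restrict_union_iff]
    refine ⟨?_, ((agreeOn_concat_left hT a b).trans ha).trans (agreeOn_concat_left hT a' b').symm⟩
    filter_upwards [h1, ae_restrict_mem measurableSet_Icc] with t ht ht'
    change (if -T < t then _ else _) = (if -T < t then _ else _)
    rw [if_neg (not_lt.2 ht'.2), if_neg (not_lt.2 ht'.2)]
    simpa using ht
  · rw [max_eq_left hs.le] at ha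
    exact ((agreeOn_concat_left hT a b).mono hs.le).trans
      (ha.trans ((agreeOn_concat_left hT a' b').mono hs.le).symm)

instance [h : Nonempty A] : Nonempty (BackwardSignal A) :=
  let ⟨a⟩ := h
  ⟨⟨fun _ => a.1, aemeasurable_const, fun _ _ => a.2⟩⟩

instance {k : ℕ} {D : Set (Vec k)} [Nonempty D] : Nonempty (BackwardStrategy A D) :=
  (inferInstance : Nonempty (BackwardSignal D)).map fun d =>
    ⟨fun _ => d, fun s _ _ _ _ => AgreeOn.refl s d⟩

end Signals

/-! ### Trajectories: gluing, locality and time invariance -/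

section Trajectories

variable {n m k : ℕ} {U : Set (Vec m)} {D : Set (Vec k)} {f : Vec n → Vec m → Vec k → Vec n}

/-- Concatenation of trajectories. -/
lemma IsBackwardTrajectory.glue {T : ℝ} (hT : 0 ≤ T) {u u₁ u₂ : BackwardSignal U}
    {d d₁ d₂ : BackwardSignal D} {x : Vec n} {y₁ y₂ : ℝ → Vec n}
    (h₁ : IsBackwardTrajectory f u₁ d₁ x y₁) (h₂ : IsBackwardTrajectory f u₂ d₂ (y₁ (-T)) y₂)
    (hu₁ : AgreeOn (-T) u u₁) (hd₁ : AgreeOn (-T) d d₁)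
    (hu₂ : ∀ τ ≤ 0, (u.shift hT).1 τ = u₂.1 τ) (hd₂ : ∀ τ ≤ 0, (d.shift hT).1 τ = d₂.1 τ) :
    IsBackwardTrajectory f u d x (fun t => if -T ≤ t then y₁ t else y₂ (t + T)) := by
  set y : ℝ → Vec n := fun t => if -T ≤ t then y₁ t else y₂ (t + T) with hy
  have hy₂ : ∀ t ≤ -T, y t = y₂ (t + T) := by
    intro t ht
    rcases ht.lt_or_eq with ht | rfl
    · exact if_neg (not_le.2 ht)
    -- At the junction both branches agree, since `y₂ 0 = y₁ (-T)`.
    · rw [hy, neg_add_cancel]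
      simpa using (h₂ 0 le_rfl).2.symm
  have hnear : ∀ t, -T ≤ t → t ≤ 0 →
      (fun s => f (y₁ s) (u₁.1 s) (d₁.1 s)) =ᵐ[volume.restrict (uIoc 0 t)]
        (fun s => f (y s) (u.1 s) (d.1 s)) := by
    intro t ht ht0
    have hsub : uIoc 0 t ⊆ Icc (-T) 0 := by
      rw [uIoc_of_ge ht0]
      exact fun s hs => ⟨ht.trans hs.1.le, hs.2⟩
    filter_upwards [ae_restrict_of_ae_restrict_of_subset hsub hu₁,
      ae_restrict_of_ae_restrict_of_subset hsub hd₁,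
      ae_restrict_mem measurableSet_uIoc] with s h1 h2 h3
    rw [h1, h2, hy]
    simp only [if_pos (hsub h3).1]
  have hint₁ : ∀ t, -T ≤ t → t ≤ 0 →
      IntervalIntegrable (fun s => f (y s) (u.1 s) (d.1 s)) volume 0 t ∧
        y t = x + ∫ s in (0 : ℝ)..t, f (y s) (u.1 s) (d.1 s) := by
    intro t ht ht0
    refine ⟨(h₁ t ht0).1.congr_ae (hnear t ht ht0), ?_⟩
    rw [← intervalIntegral.integral_congr_ae_restrict (hnear t ht ht0), ← (h₁ t ht0).2]
    exact if_pos ht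
  intro t ht
  rcases le_or_gt (-T) t with hTt | hTt
  · exact hint₁ t hTt ht
  · have hfar : EqOn (fun s => f (y₂ (s + T)) (u₂.1 (s + T)) (d₂.1 (s + T)))
        (fun s => f (y s) (u.1 s) (d.1 s)) (uIcc (-T) t) := by
      intro s hs
      rw [uIcc_of_ge hTt.le] at hs
      have hs0 : s + T ≤ 0 := by linarith [hs.2]
      have e1 := hu₂ _ hs0
      have e2 := hd₂ _ hs0
      simp only [BackwardSignal.shift, add_sub_cancel_right] at e1 e2
      simp only [hy₂ s hs.2, e1, e2]
    have hi := (h₂ (t + T) (by linarith)).1.comp_add_right T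
    rw [zero_sub, add_sub_cancel_right] at hi
    have hi' := hi.congr (hfar.mono uIoc_subset_uIcc)
    obtain ⟨hi₁, hv₁⟩ := hint₁ (-T) le_rfl (by linarith)
    refine ⟨hi₁.trans hi', ?_⟩
    rw [← intervalIntegral.integral_add_adjacent_intervals hi₁ hi', ← add_assoc, ← hv₁,
      ← intervalIntegral.integral_congr hfar,
      intervalIntegral.integral_comp_add_right (fun s => f (y₂ s) (u₂.1 s) (d₂.1 s)),
      neg_add_cancel, hy₂ t hTt.le, (h₂ (t + T) (by linarith)).2]
    congr 1
    exact (if_pos le_rfl).symm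

variable (U D f) in
/-- Joint continuity on `ℝⁿ × U × D`, uniform Lipschitz continuity in the state, boundedness. -/
structure AdmissibleDynamics (L : NNReal) (M : ℝ) : Prop where
  closed_control : IsClosed U
  closed_disturbance : IsClosed D
  continuousOn : ContinuousOn (fun p : Vec n × Vec m × Vec k => f p.1 p.2.1 p.2.2)
    (univ ×ˢ U ×ˢ D)
  lipschitz : ∀ u ∈ U, ∀ d ∈ D, LipschitzWith L fun x => f x u d
  bounded : ∀ x, ∀ u ∈ U, ∀ d ∈ D, ‖f x u d‖ ≤ M

variable {L : NNReal} {M : ℝ}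

namespace AdmissibleDynamics

lemma aestronglyMeasurable (hf : AdmissibleDynamics U D f L M) (u : BackwardSignal U)
    (d : BackwardSignal D) {y : ℝ → Vec n} (hy : Continuous y) :
    AEStronglyMeasurable (fun s => f (y s) (u.1 s) (d.1 s)) (volume.restrict (Iic 0)) := by
  have hS : MeasurableSet ((univ : Set (Vec n)) ×ˢ U ×ˢ D) :=
    MeasurableSet.univ.prod (hf.closed_control.measurableSet.prod
      hf.closed_disturbance.measurableSet)
  classical
  -- Continuity of `f` is known only on `ℝⁿ × U × D`. Replacing `f` by zero off this closed set
  -- gives a Borel function, with the same values along signals at times `s ≤ 0`.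
  have hF : Measurable (((univ : Set (Vec n)) ×ˢ U ×ˢ D).piecewise
      (fun p : Vec n × Vec m × Vec k => f p.1 p.2.1 p.2.2) (fun _ => 0)) :=
    hf.continuousOn.measurable_piecewise continuousOn_const hS
  have hp : AEMeasurable (fun s => (y s, u.1 s, d.1 s)) (volume.restrict (Iic 0)) :=
    hy.measurable.aemeasurable.prodMk (u.2.1.prodMk d.2.1)
  refine (hF.comp_aemeasurable hp).aestronglyMeasurable.congr ?_
  filter_upwards [ae_restrict_mem measurableSet_Iic] with s hs
  exact piecewise_eq_of_mem _ _ _ ⟨mem_univ _, u.2.2 s hs, d.2.2 s hs⟩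

lemma exists_unique (hf : AdmissibleDynamics U D f L M) (u : BackwardSignal U)
    (d : BackwardSignal D) (x : Vec n) :
    ∃ y, IsBackwardTrajectory f u d x y ∧
      ∀ w, IsBackwardTrajectory f u d x w → EqOn w y (Iic 0) :=
  exists_unique_integral_curve (G := fun s y => f y (u.1 s) (d.1 s)) (L := L) (M := M)
    (fun s hs => hf.lipschitz _ (u.2.2 s hs) _ (d.2.2 s hs))
    (fun s hs y => hf.bounded y _ (u.2.2 s hs) _ (d.2.2 s hs))
    (fun _ hy => hf.aestronglyMeasurable u d hy) x

lemma isBackwardTrajectory (hf : AdmissibleDynamics U D f L M) (u : BackwardSignal U)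
    (d : BackwardSignal D) (x : Vec n) :
    IsBackwardTrajectory f u d x (backwardTrajectory f u d x) :=
  let ⟨y, hy, _⟩ := hf.exists_unique u d x
  Classical.epsilon_spec (p := IsBackwardTrajectory f u d x) ⟨y, hy⟩

lemma eqOn_backwardTrajectory (hf : AdmissibleDynamics U D f L M) {u : BackwardSignal U}
    {d : BackwardSignal D} {x : Vec n} {y : ℝ → Vec n} (hy : IsBackwardTrajectory f u d x y) :
    EqOn y (backwardTrajectory f u d x) (Iic 0) :=
  let ⟨_, _, hu⟩ := hf.exists_unique u d x
  (hu y hy).trans (hu _ (hf.isBackwardTrajectory u d x)).symm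

lemma backwardTrajectory_zero (hf : AdmissibleDynamics U D f L M) (u : BackwardSignal U)
    (d : BackwardSignal D) (x : Vec n) : backwardTrajectory f u d x 0 = x := by
  simpa using (hf.isBackwardTrajectory u d x 0 le_rfl).2

lemma norm_backwardTrajectory_le (hf : AdmissibleDynamics U D f L M) (u : BackwardSignal U)
    (d : BackwardSignal D) (x : Vec n) {t : ℝ} (ht : t ≤ 0) :
    ‖backwardTrajectory f u d x t‖ ≤ ‖x‖ + M * |t| := by
  rw [(hf.isBackwardTrajectory u d x t ht).2]
  refine (norm_add_le _ _).trans ?_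
  gcongr
  have := intervalIntegral.norm_integral_le_of_norm_le_const (a := 0) (b := t) (C := M)
    (f := fun s => f (backwardTrajectory f u d x s) (u.1 s) (d.1 s)) fun s hs => by
      rw [uIoc_of_ge ht] at hs
      exact hf.bounded _ _ (u.2.2 s hs.2) _ (d.2.2 s hs.2)
  simpa using this

lemma continuousOn_backwardTrajectory (hf : AdmissibleDynamics U D f L M) (u : BackwardSignal U)
    (d : BackwardSignal D) (x : Vec n) (T : ℝ) (hT : 0 ≤ T) :
    ContinuousOn (backwardTrajectory f u d x) (Icc (-T) 0) := by
  have h := hf.isBackwardTrajectory u d x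
  have hc := intervalIntegral.continuousOn_primitive_interval' (h (-T) (by linarith)).1
    left_mem_uIcc
  rw [uIcc_of_ge (by linarith)] at hc
  exact (continuousOn_const.add hc).congr fun t ht => (h t ht.2).2

section Concat

variable {T : ℝ} {u u₁ u₂ : BackwardSignal U} {d d₁ d₂ : BackwardSignal D}

/-- Continuing the trajectory of `(u₁, d₁)` before `-T` by the shifted signals of `(u, d)` solves
the equation for `(u, d)`; uniqueness concludes. This locality makes switching strategies at `-T`
non-anticipative. -/
lemma backwardTrajectory_eq_of_agreeOn (hf : AdmissibleDynamics U D f L M) (hT : 0 ≤ T)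
    (hu₁ : AgreeOn (-T) u u₁) (hd₁ : AgreeOn (-T) d d₁) (x : Vec n) :
    EqOn (backwardTrajectory f u d x) (backwardTrajectory f u₁ d₁ x) (Icc (-T) 0) := by
  intro t ht
  have := hf.eqOn_backwardTrajectory ((hf.isBackwardTrajectory u₁ d₁ x).glue hT
    (hf.isBackwardTrajectory (u.shift hT) (d.shift hT) _) hu₁ hd₁ (fun _ _ => rfl)
    (fun _ _ => rfl)) (mem_Iic.2 ht.2)
  rw [← this]
  exact if_pos ht.1

/-- Time invariance: `f` has no explicit time dependence, so restarting at the state reached at `-T`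
and gluing gives a solution, which uniqueness identifies with the original one. -/
lemma backwardTrajectory_sub (hf : AdmissibleDynamics U D f L M) (hT : 0 ≤ T)
    (hu₂ : ∀ τ ≤ 0, (u.shift hT).1 τ = u₂.1 τ) (hd₂ : ∀ τ ≤ 0, (d.shift hT).1 τ = d₂.1 τ)
    (x : Vec n) {τ : ℝ} (hτ : τ ≤ 0) :
    backwardTrajectory f u d x (τ - T) =
      backwardTrajectory f u₂ d₂ (backwardTrajectory f u d x (-T)) τ := by
  have := hf.eqOn_backwardTrajectory ((hf.isBackwardTrajectory u d x).glue hT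
    (hf.isBackwardTrajectory u₂ d₂ _) (AgreeOn.refl _ _) (AgreeOn.refl _ _) hu₂ hd₂)
    (mem_Iic.2 (by linarith : τ - T ≤ 0))
  rw [← this]
  split_ifs with h
  · have : τ = 0 := by linarith
    rw [this, zero_sub, hf.backwardTrajectory_zero]
  · rw [sub_add_cancel]

end Concat

end AdmissibleDynamics

end Trajectories

/-! ### Near-optimal choices in a finite sup-inf -/

section SupInf

variable {α β : Type*} {F : α → β → ℝ}

lemma supInfFinite_of_bounds [Nonempty β] {a b : ℝ} (ha : ∀ i j, a ≤ F i j)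
    (hb : ∀ i j, F i j ≤ b) :
    SupInfFinite F :=
  have hB : ∀ i, BddBelow (range (F i)) := fun i => ⟨a, by rintro _ ⟨j, rfl⟩; exact ha i j⟩
  ⟨hB, b, by
    rintro _ ⟨i, rfl⟩
    exact (ciInf_le (hB i) (Classical.arbitrary β)).trans (hb i _)⟩

lemma SupInfFinite.le_iSup_iInf [Nonempty β] (hF : SupInfFinite F) {c : ℝ} (i : α)
    (h : ∀ j, c ≤ F i j) :
    c ≤ ⨆ i, ⨅ j, F i j :=
  (le_ciInf h).trans (le_ciSup hF.2 i)

lemma SupInfFinite.exists_forall_lt [Nonempty α] (hF : SupInfFinite F) {c : ℝ}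
    (h : c < ⨆ i, ⨅ j, F i j) :
    ∃ i, ∀ j, c < F i j :=
  let ⟨i, hi⟩ := exists_lt_of_lt_ciSup h
  ⟨i, fun j => hi.trans_le (ciInf_le (hF.1 i) j)⟩

lemma SupInfFinite.exists_lt [Nonempty β] (hF : SupInfFinite F) {c : ℝ} (i : α)
    (h : ⨆ i, ⨅ j, F i j < c) :
    ∃ j, F i j < c :=
  exists_lt_of_ciInf_lt ((le_ciSup hF.2 i).trans_lt h)

end SupInf

/-! ### Payoff bounds, splitting of the cost, and the two inequalities -/

section Values

variable {n m k : ℕ} {U : Set (Vec m)} {D : Set (Vec k)} {f : Vec n → Vec m → Vec k → Vec n}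
  {L : NNReal} {M C γ T : ℝ} {h : Vec n → ℝ}

namespace AdmissibleDynamics

/-- The state has norm at most `‖x‖ + M|t|` and `e^{γt}|t| ≤ 1/γ` for `t ≤ 0`. The bound depends
neither on the signals nor on `t`, which gives all upper finiteness claims. -/
lemma payoff_le (hf : AdmissibleDynamics U D f L M) (hM : 0 ≤ M)
    (hh : ∀ x, |h x| ≤ C * (1 + ‖x‖)) (hC : 0 ≤ C) (hγ : 0 < γ) (x : Vec n)
    (u : BackwardSignal U) (d : BackwardSignal D) {t : ℝ} (ht : t ≤ 0) :
    payoff f h γ x u d t ≤ C * (1 + ‖x‖ + M * γ⁻¹) := by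
  have h1 := exp_neg_mul_abs_mul_abs_le hγ t
  have h2 : Real.exp (-(γ * |t|)) ≤ 1 := Real.exp_le_one_iff.2 (by
    have := mul_nonneg hγ.le (abs_nonneg t); linarith)
  have h3 : Real.exp (γ * t) = Real.exp (-(γ * |t|)) := by rw [abs_of_nonpos ht]; ring_nf
  rw [payoff, h3]
  calc _ ≤ Real.exp (-(γ * |t|)) * (C * (1 + (‖x‖ + M * |t|))) := by
        gcongr
        refine (le_abs_self _).trans ((hh _).trans ?_)
        gcongr
        exact hf.norm_backwardTrajectory_le u d x ht
    _ = C * (Real.exp (-(γ * |t|)) * (1 + ‖x‖) + M * (Real.exp (-(γ * |t|)) * |t|)) := by ring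
    _ ≤ C * (1 * (1 + ‖x‖) + M * γ⁻¹) := by gcongr
    _ = _ := by ring

lemma payoff_zero (hf : AdmissibleDynamics U D f L M) (x : Vec n)
    (u : BackwardSignal U) (d : BackwardSignal D) : payoff f h γ x u d 0 = h x := by
  simp [payoff, hf.backwardTrajectory_zero]

lemma isGreatest_payoff (hf : AdmissibleDynamics U D f L M) (hh : Continuous h) (hT : 0 ≤ T)
    (x : Vec n) (u : BackwardSignal U) (d : BackwardSignal D) :
    IsGreatest (payoff f h γ x u d '' Icc (-T) 0) (sSup (payoff f h γ x u d '' Icc (-T) 0)) := by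
  have hc : ContinuousOn (payoff f h γ x u d) (Icc (-T) 0) :=
    ContinuousOn.mul (by fun_prop)
      (hh.comp_continuousOn (hf.continuousOn_backwardTrajectory u d x T hT))
  exact (isCompact_Icc.image_of_continuousOn hc).isGreatest_sSup
    ((nonempty_Icc.2 (by linarith)).image _)

open scoped Pointwise in
/-- The cost splits at time `-T`. -/
lemma sSup_payoff_split (hf : AdmissibleDynamics U D f L M) (hM : 0 ≤ M)
    (hh : ∀ x, |h x| ≤ C * (1 + ‖x‖)) (hC : 0 ≤ C) (hγ : 0 < γ) (hT : 0 ≤ T)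
    {u u₁ u₂ : BackwardSignal U} {d d₁ d₂ : BackwardSignal D}
    (hu₁ : AgreeOn (-T) u u₁) (hd₁ : AgreeOn (-T) d d₁)
    (hu₂ : ∀ τ ≤ 0, (u.shift hT).1 τ = u₂.1 τ) (hd₂ : ∀ τ ≤ 0, (d.shift hT).1 τ = d₂.1 τ)
    (x : Vec n) :
    sSup (payoff f h γ x u d '' Iic 0) =
      max (sSup (payoff f h γ x u₁ d₁ '' Icc (-T) 0))
        (Real.exp (-(γ * T)) *
          sSup (payoff f h γ (backwardTrajectory f u₁ d₁ x (-T)) u₂ d₂ '' Iic 0)) := by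
  have hT' : -T ≤ 0 := by linarith
  have hnear := hf.backwardTrajectory_eq_of_agreeOn hT hu₁ hd₁ x
  have hbdd : BddAbove (payoff f h γ x u d '' Iic 0) :=
    ⟨_, by rintro _ ⟨t, ht, rfl⟩; exact hf.payoff_le hM hh hC hγ x u d ht⟩
  have h1 : payoff f h γ x u d '' Icc (-T) 0 = payoff f h γ x u₁ d₁ '' Icc (-T) 0 :=
    image_congr fun t ht => by rw [payoff, payoff, hnear ht]
  -- With `t = τ - T`, the discount factors as `e^{-γT} e^{γτ}` and the state at `t` is that of the
  -- restarted trajectory at `τ`.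
  have h2 : payoff f h γ x u d '' Iic (-T) = Real.exp (-(γ * T)) •
      (payoff f h γ (backwardTrajectory f u₁ d₁ x (-T)) u₂ d₂ '' Iic 0) := by
    have hI : Iic (-T) = (fun τ => τ - T) '' Iic 0 := by simp
    rw [hI, image_image, ← image_smul, image_image]
    refine image_congr fun τ hτ => ?_
    rw [payoff, payoff, hf.backwardTrajectory_sub hT hu₂ hd₂ x hτ,
      hnear (left_mem_Icc.2 hT'), smul_eq_mul, ← mul_assoc, ← Real.exp_add]
    ring_nf
  have hunion : Iic (0 : ℝ) = Icc (-T) 0 ∪ Iic (-T) := by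
    rw [union_comm, Iic_union_Icc_eq_Iic hT']
  rw [hunion, image_union, csSup_union (hbdd.mono (image_mono Icc_subset_Iic_self))
    ((nonempty_Icc.2 hT').image _) (hbdd.mono (image_mono (Iic_subset_Iic.2 hT')))
    (nonempty_Iic.image _), h1, h2, Real.sSup_smul_of_nonneg (Real.exp_pos _).le, smul_eq_mul,
    ← hunion]

end AdmissibleDynamics

/-- Before time `-T`, the strategy `σ` responds to a control that ends with `u` on `[-T, 0]`. -/
def BackwardStrategy.tail (hT : 0 ≤ T) (σ : BackwardStrategy U D) (u : BackwardSignal U) :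
    BackwardStrategy U D :=
  ⟨fun v => (σ.1 (u.concat hT v)).shift hT, fun s hs v w hvw => by
    -- Controls agreeing on `[s, 0]` become, behind the common `u`, controls agreeing on `[s - T,
    -- 0]`, where `σ` is non-anticipative.
    refine AgreeOn.shift hT (σ.2 (s - T) (by linarith) _ _ (AgreeOn.concat hT (AgreeOn.refl _ _) ?_))
    intro _
    rwa [sub_add_cancel]⟩

/-- Follow `σ` on `[-T, 0]`; before time `-T`, follow the strategy that `ρ` assigns to the state
reached at time `-T`. -/
def BackwardStrategy.switch (hf : AdmissibleDynamics U D f L M) (hT : 0 ≤ T) (x : Vec n)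
    (σ : BackwardStrategy U D) (ρ : Vec n → BackwardStrategy U D) : BackwardStrategy U D :=
  ⟨fun u => (σ.1 u).concat hT
      ((ρ (backwardTrajectory f u (σ.1 u) x (-T))).1 (u.shift hT)), fun s hs u v huv => by
    refine AgreeOn.concat hT ((σ.2 s hs u v huv).mono (le_max_left _ _)) fun hsT => ?_
    have hT' : -T ≤ 0 := by linarith
    -- The second piece matters only for `s ≤ -T`. Then the controls agree on `[-T, 0]`, reach the
    -- same state, and `ρ` selects the same strategy for both.
    rw [hf.backwardTrajectory_eq_of_agreeOn hT (huv.mono hsT) ((σ.2 s hs u v huv).mono hsT) x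
      (left_mem_Icc.2 hT')]
    refine (ρ _).2 _ (by linarith) _ _ (AgreeOn.shift hT ?_)
    rwa [add_sub_cancel_right]⟩

namespace AdmissibleDynamics

/-- Time `0` contributes `h x` to the supremum whatever the signals, so the infima over controls are
bounded below. -/
lemma le_cost (hf : AdmissibleDynamics U D f L M) (hM : 0 ≤ M)
    (hh : ∀ x, |h x| ≤ C * (1 + ‖x‖)) (hC : 0 ≤ C) (hγ : 0 < γ) (x : Vec n)
    (u : BackwardSignal U) (σ : BackwardStrategy U D) : h x ≤ cost f h γ x u σ := by
  rw [← hf.payoff_zero (h := h) (γ := γ) x u (σ.1 u)]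
  refine le_csSup ⟨C * (1 + ‖x‖ + M * γ⁻¹), ?_⟩ (mem_image_of_mem _ self_mem_Iic)
  rintro _ ⟨t, ht, rfl⟩
  exact hf.payoff_le hM hh hC hγ x u _ ht

lemma cost_le (hf : AdmissibleDynamics U D f L M) (hM : 0 ≤ M)
    (hh : ∀ x, |h x| ≤ C * (1 + ‖x‖)) (hC : 0 ≤ C) (hγ : 0 < γ) (x : Vec n)
    (u : BackwardSignal U) (σ : BackwardStrategy U D) :
    cost f h γ x u σ ≤ C * (1 + ‖x‖ + M * γ⁻¹) := by
  refine csSup_le (nonempty_Iic.image _) ?_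
  rintro _ ⟨t, ht, rfl⟩
  exact hf.payoff_le hM hh hC hγ x u _ ht

variable [Nonempty U]

lemma supInfFinite_cost (hf : AdmissibleDynamics U D f L M) (hM : 0 ≤ M)
    (hh : ∀ x, |h x| ≤ C * (1 + ‖x‖)) (hC : 0 ≤ C) (hγ : 0 < γ) (x : Vec n) :
    SupInfFinite fun (σ : BackwardStrategy U D) (u : BackwardSignal U) => cost f h γ x u σ :=
  supInfFinite_of_bounds (fun σ u => hf.le_cost hM hh hC hγ x u σ)
    (fun σ u => hf.cost_le hM hh hC hγ x u σ)

variable [Nonempty D]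

lemma valueFunction_le (hf : AdmissibleDynamics U D f L M) (hM : 0 ≤ M)
    (hh : ∀ x, |h x| ≤ C * (1 + ‖x‖)) (hC : 0 ≤ C) (hγ : 0 < γ) (x : Vec n) :
    valueFunction U D f h γ x ≤ C * (1 + ‖x‖ + M * γ⁻¹) :=
  ciSup_le fun σ => (ciInf_le ((hf.supInfFinite_cost hM hh hC hγ x).1 σ)
    (Classical.arbitrary _)).trans (hf.cost_le hM hh hC hγ x _ σ)

lemma supInfFinite_dynProgCost (hf : AdmissibleDynamics U D f L M) (hM : 0 ≤ M)
    (hh_cont : Continuous h) (hh : ∀ x, |h x| ≤ C * (1 + ‖x‖)) (hC : 0 ≤ C) (hγ : 0 < γ)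
    (hT : 0 ≤ T) (x : Vec n) :
    SupInfFinite fun (σ : BackwardStrategy U D) (u : BackwardSignal U) =>
      dynProgCost f h γ T x u σ := by
  have hT' : -T ≤ 0 := by linarith
  -- The upper bound is the payoff bound for states of norm at most `‖x‖ + M * T`, which include
  -- every state reachable at `-T`.
  refine supInfFinite_of_bounds (a := h x) (b := C * (1 + (‖x‖ + M * T) + M * γ⁻¹))
    (fun σ u => ?_) (fun σ u => max_le ?_ ?_)
  · refine le_trans ?_ (le_max_left _ _)
    rw [← hf.payoff_zero (h := h) (γ := γ) x u (σ.1 u)]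
    exact (hf.isGreatest_payoff hh_cont hT x u (σ.1 u)).2
      (mem_image_of_mem _ (right_mem_Icc.2 hT'))
  · refine csSup_le ((nonempty_Icc.2 hT').image _) ?_
    rintro _ ⟨t, ht, rfl⟩
    refine (hf.payoff_le hM hh hC hγ x u _ ht.2).trans ?_
    gcongr
    exact le_add_of_nonneg_right (by positivity)
  · have hexp : Real.exp (-(γ * T)) ≤ 1 := Real.exp_le_one_iff.2 (by
      have := mul_nonneg hγ.le hT; linarith)
    have hz := hf.norm_backwardTrajectory_le u (σ.1 u) x hT'
    rw [abs_neg, abs_of_nonneg hT] at hz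
    calc _ ≤ Real.exp (-(γ * T)) * (C * (1 + (‖x‖ + M * T) + M * γ⁻¹)) := by
          gcongr
          refine (hf.valueFunction_le hM hh hC hγ _).trans ?_
          gcongr
      _ ≤ 1 * (C * (1 + (‖x‖ + M * T) + M * γ⁻¹)) := by gcongr
      _ = _ := one_mul _

lemma valueFunction_le_iSup_iInf_dynProgCost (hf : AdmissibleDynamics U D f L M) (hM : 0 ≤ M)
    (hh_cont : Continuous h) (hh : ∀ x, |h x| ≤ C * (1 + ‖x‖)) (hC : 0 ≤ C) (hγ : 0 < γ)
    (hT : 0 ≤ T) (x : Vec n) :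
    valueFunction U D f h γ x ≤
      ⨆ σ : BackwardStrategy U D, ⨅ u : BackwardSignal U, dynProgCost f h γ T x u σ := by
  refine le_of_forall_pos_lt_add fun ε hε => ?_
  have hexp : Real.exp (-(γ * T)) ≤ 1 := Real.exp_le_one_iff.2 (by
    have := mul_nonneg hγ.le hT; linarith)
  obtain ⟨σ, hσ⟩ := (hf.supInfFinite_cost hM hh hC hγ x).exists_forall_lt
    (c := valueFunction U D f h γ x - ε / 3) (sub_lt_self _ (by positivity))
  have key : ∀ u, valueFunction U D f h γ x - ε / 3 - ε / 3 ≤ dynProgCost f h γ T x u σ := by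
    intro u
    set z := backwardTrajectory f u (σ.1 u) x (-T) with hz
    -- No strategy guarantees more than `V(z)` at `z`, so some control holds the tail of `σ` below
    -- `V(z) + ε/3`. One `ε/3` is lost here and one in choosing `σ`; the third leaves the final
    -- inequality strict.
    obtain ⟨v, hv⟩ := (hf.supInfFinite_cost hM hh hC hγ z).exists_lt (σ.tail hT u)
      (c := valueFunction U D f h γ z + ε / 3) (lt_add_of_pos_right _ (by positivity))
    have hu := agreeOn_concat_left hT u v
    have hsplit : cost f h γ x (u.concat hT v) σ = max (horizonMax f h γ T x u σ)
        (Real.exp (-(γ * T)) * cost f h γ z v (σ.tail hT u)) :=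
      hf.sSup_payoff_split hM hh hC hγ hT hu (σ.2 _ (by linarith) _ _ hu)
        (fun _ hτ => shift_concat_apply hT u v hτ) (fun _ _ => rfl) x
    have hlt := (hσ (u.concat hT v)).le
    rw [hsplit] at hlt
    have : max (horizonMax f h γ T x u σ)
        (Real.exp (-(γ * T)) * cost f h γ z v (σ.tail hT u)) ≤
        dynProgCost f h γ T x u σ + ε / 3 := by
      refine max_le ?_ ?_
      · exact (le_max_left _ _).trans (le_add_of_nonneg_right (by positivity))
      · calc _ ≤ Real.exp (-(γ * T)) * (valueFunction U D f h γ z + ε / 3) := by gcongr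
          _ = Real.exp (-(γ * T)) * valueFunction U D f h γ z +
              Real.exp (-(γ * T)) * (ε / 3) := by ring
          _ ≤ dynProgCost f h γ T x u σ + 1 * (ε / 3) := by
              gcongr
              exact le_max_right _ _
          _ = _ := by rw [one_mul]
    linarith
  linarith [(hf.supInfFinite_dynProgCost hM hh_cont hh hC hγ hT x).le_iSup_iInf σ key]

lemma iSup_iInf_dynProgCost_le_valueFunction (hf : AdmissibleDynamics U D f L M) (hM : 0 ≤ M)
    (hh_cont : Continuous h) (hh : ∀ x, |h x| ≤ C * (1 + ‖x‖)) (hC : 0 ≤ C) (hγ : 0 < γ)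
    (hT : 0 ≤ T) (x : Vec n) :
    ⨆ σ : BackwardStrategy U D, ⨅ u : BackwardSignal U, dynProgCost f h γ T x u σ ≤
      valueFunction U D f h γ x := by
  refine le_of_forall_pos_lt_add fun ε hε => ?_
  have hexp : Real.exp (-(γ * T)) ≤ 1 := Real.exp_le_one_iff.2 (by
    have := mul_nonneg hγ.le hT; linarith)
  set W := ⨆ σ : BackwardStrategy U D, ⨅ u : BackwardSignal U, dynProgCost f h γ T x u σ with hW
  obtain ⟨σ, hσ⟩ := (hf.supInfFinite_dynProgCost hM hh_cont hh hC hγ hT x).exists_forall_lt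
    (c := W - ε / 3) (sub_lt_self _ (by positivity))
  have hρ : ∀ z, ∃ ρ : BackwardStrategy U D, ∀ v : BackwardSignal U,
      valueFunction U D f h γ z - ε / 3 < cost f h γ z v ρ := fun z =>
    (hf.supInfFinite_cost hM hh hC hγ z).exists_forall_lt (sub_lt_self _ (by positivity))
  -- No measurability of `z ↦ ρ z` is needed: for each control, only the strategy at the single
  -- state reached at `-T` is used.
  choose ρ hρ using hρ
  have key : ∀ u, W - ε / 3 - ε / 3 ≤
      cost f h γ x u (BackwardStrategy.switch hf hT x σ ρ) := by
    intro u
    set z := backwardTrajectory f u (σ.1 u) x (-T) with hz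
    have hsplit : cost f h γ x u (BackwardStrategy.switch hf hT x σ ρ) =
        max (horizonMax f h γ T x u σ)
          (Real.exp (-(γ * T)) * cost f h γ z (u.shift hT) (ρ z)) :=
      -- Here the disturbance is the concatenated signal and the control is merely cut at `-T`; in
      -- the opposite inequality the roles are reversed.
      hf.sSup_payoff_split hM hh hC hγ hT (AgreeOn.refl _ u) (agreeOn_concat_left hT _ _)
        (fun _ _ => rfl) (fun _ hτ => shift_concat_apply hT _ _ hτ) x
    have : dynProgCost f h γ T x u σ ≤
        cost f h γ x u (BackwardStrategy.switch hf hT x σ ρ) + ε / 3 := by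
      rw [hsplit]
      refine max_le ((le_max_left _ _).trans (le_add_of_nonneg_right (by positivity))) ?_
      calc Real.exp (-(γ * T)) * valueFunction U D f h γ z
          ≤ Real.exp (-(γ * T)) * (cost f h γ z (u.shift hT) (ρ z) + ε / 3) := by
            gcongr
            linarith [hρ z (u.shift hT)]
        _ = Real.exp (-(γ * T)) * cost f h γ z (u.shift hT) (ρ z) +
            Real.exp (-(γ * T)) * (ε / 3) := by ring
        _ ≤ max (horizonMax f h γ T x u σ)
            (Real.exp (-(γ * T)) * cost f h γ z (u.shift hT) (ρ z)) + 1 * (ε / 3) := by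
            gcongr
            exact le_max_right _ _
        _ = _ := by rw [one_mul]
    linarith [hσ u]
  have := (hf.supInfFinite_cost hM hh hC hγ x).le_iSup_iInf _ key
  change _ ≤ valueFunction U D f h γ x at this
  linarith

end AdmissibleDynamics

end Values

end

theorem mainTheorem6 {n m k : ℕ} (U : Set (Vec m)) (D : Set (Vec k))
    (hU : IsCompact U) (hU' : U.Nonempty) (hD : IsCompact D) (hD' : D.Nonempty)
    (f : Vec n → Vec m → Vec k → Vec n)
    (hf_cont : UniformContinuousOn (fun p : Vec n × Vec m × Vec k => f p.1 p.2.1 p.2.2)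
      (univ ×ˢ U ×ˢ D))
    (hf_lip : ∃ L : NNReal, ∀ u ∈ U, ∀ d ∈ D, LipschitzWith L fun x => f x u d)
    (hf_bdd : ∃ M : ℝ, ∀ x, ∀ u ∈ U, ∀ d ∈ D, ‖f x u d‖ ≤ M)
    (h : Vec n → ℝ) (hh_cont : Continuous h)
    (hh_growth : ∃ C : ℝ, ∀ x, |h x| ≤ C * (1 + ‖x‖))
    (γ : ℝ) (hγ : 0 < γ) :
    -- trajectories exist and are unique
    (∀ (x : Vec n) (u : BackwardSignal U) (d : BackwardSignal D),
      IsBackwardTrajectory f u d x (backwardTrajectory f u d x) ∧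
      ∀ y, IsBackwardTrajectory f u d x y → EqOn y (backwardTrajectory f u d x) (Iic 0)) ∧
    -- the value function is well defined, with finite values
    (∀ x : Vec n,
      (∀ (u : BackwardSignal U) (σ : BackwardStrategy U D),
        BddAbove (payoff f h γ x u (σ.1 u) '' Iic 0)) ∧
      SupInfFinite fun (σ : BackwardStrategy U D) (u : BackwardSignal U) => cost f h γ x u σ) ∧
    -- the dynamic programming principle, both sides being well defined
    ∀ (x : Vec n) (T : ℝ), 0 < T →
      (∀ (u : BackwardSignal U) (σ : BackwardStrategy U D),
        IsGreatest (payoff f h γ x u (σ.1 u) '' Icc (-T) 0) (horizonMax f h γ T x u σ)) ∧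
      (SupInfFinite fun (σ : BackwardStrategy U D) (u : BackwardSignal U) =>
        dynProgCost f h γ T x u σ) ∧
      valueFunction U D f h γ x =
        ⨆ σ : BackwardStrategy U D, ⨅ u : BackwardSignal U, dynProgCost f h γ T x u σ := by
  obtain ⟨L, hL⟩ := hf_lip
  obtain ⟨M, hM⟩ := hf_bdd
  obtain ⟨C, hC⟩ := hh_growth
  have := hU'.to_subtype
  have := hD'.to_subtype
  have hM0 : 0 ≤ M := (norm_nonneg _).trans (hM 0 _ hU'.some_mem _ hD'.some_mem)
  have hC0 : 0 ≤ C := by simpa using (abs_nonneg _).trans (hC 0)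
  have hf : AdmissibleDynamics U D f L M :=
    ⟨hU.isClosed, hD.isClosed, hf_cont.continuousOn, hL, hM⟩
  refine ⟨fun x u d => ⟨hf.isBackwardTrajectory u d x, fun y => hf.eqOn_backwardTrajectory⟩,
    fun x => ⟨fun u σ => ⟨C * (1 + ‖x‖ + M * γ⁻¹), ?_⟩, hf.supInfFinite_cost hM0 hC hC0 hγ x⟩,
    fun x T hT => ⟨fun u σ => hf.isGreatest_payoff hh_cont hT.le x u (σ.1 u),
      hf.supInfFinite_dynProgCost hM0 hh_cont hC hC0 hγ hT.le x,
      le_antisymm (hf.valueFunction_le_iSup_iInf_dynProgCost hM0 hh_cont hC hC0 hγ hT.le x)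
        (hf.iSup_iInf_dynProgCost_le_valueFunction hM0 hh_cont hC hC0 hγ hT.le x)⟩⟩
  rintro _ ⟨t, ht, rfl⟩
  exact hf.payoff_le hM0 hC hC0 hγ x u _ ht
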